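/- Let $n\ge 2$ and let $A\in\mathbb C^{n\times n}$ be a matrix whose columns $a_1,\dots,a_n$ are linearly independent unit vectors of $\mathbb C^n$ (Euclidean norm). For distinct $i,j\in\{1,\dots,n\}$ let $\mathrm{orth}(A,i,j)$ be the matrix obtained from $A$ by replacing its $i$-th column by $$\frac{a_i-\langle a_i,a_j\rangle a_j}{\|a_i-\langle a_i,a_j\rangle a_j\|},\qquad \langle x,y\rangle=y^*x ,$$ and keeping all other columns. Let $(i_t,j_t)_{t\ge 0}$ be independent and uniformly distributed on the ordered pairs of distinct indices, and put $A_0=A$, $A_{t+1}=\mathrm{orth}(A_t,i_t,j_t)$. Let $$\Phi(A)=-\sum_{j=1}^n\log \mathrm{dist}\big(a_j,\mathrm{span}\{a_k:k\ne j\}\big),$$ and let $\kappa(M)=\sigma_1(M)/\sigma_n(M)$ be the ratio of the largest to the smallest singular value of an invertible matrix $M\in\mathbb C^{n\times n}$. Suppose that $\Phi(A)\ge\frac{\log 2}{2}\,n$. Then for every integer $t$ with $0\le t\le n^2\,\Phi(A)$, the matrix $A_t$ is always invertible, $\log\kappa(A_t)$ is integrable, and $$\mathbb E\log\kappa(A_t)\;\le\;\log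 n+\Phi(A)-\frac1{96}\left(1-\frac{\frac{\log 2}{2}\,n}{\Phi(A)}\right)\frac{t}{n^2}.$$ -/

import Mathlib

namespace PairOrth

/-- The `j`-th column `a_j` of a complex `n × n` matrix, as a vector of the Hermitian space `ℂⁿ`
(with its Euclidean norm). -/
noncomputable def column {n : ℕ} (A : Matrix (Fin n) (Fin n) ℂ) (j : Fin n) :
    EuclideanSpace ℂ (Fin n) :=
  WithLp.toLp 2 (fun i => A i j)

/-- Ordered pairs of distinct indices. -/
abbrev IndexPair (n : ℕ) : Type := {p : Fin n × Fin n // p.1 ≠ p.2}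

/-- The component of `a_i` orthogonal to `a_j` (for a unit vector `a_j`). Mathlib's inner product is
linear in its second argument, so `inner ℂ a_j a_i` is the number `a_j^* a_i`. -/
noncomputable def residual {n : ℕ} (A : Matrix (Fin n) (Fin n) ℂ) (p : IndexPair n) :
    EuclideanSpace ℂ (Fin n) :=
  column A p.1.1 - inner ℂ (column A p.1.2) (column A p.1.1) • column A p.1.2

/-- One orthogonalization step with the pair `(i, j)`: column `i` is replaced by its component
orthogonal to column `j`, renormalized; all other columns are kept. -/
noncomputable def orth {n : ℕ} (A : Matrix (Fin n) (Fin n) ℂ) (p : IndexPair n) :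
    Matrix (Fin n) (Fin n) ℂ :=
  A.updateCol p.1.1 (fun k => ((‖residual A p‖⁻¹ : ℝ) : ℂ) * residual A p k)

/-- The matrices `A_0 = A`, `A_{t+1} = orth(A_t, i_t, j_t)` for a given sequence of pairs. -/
noncomputable def iterate {n : ℕ} (A : Matrix (Fin n) (Fin n) ℂ) (p : ℕ → IndexPair n) :
    ℕ → Matrix (Fin n) (Fin n) ℂ
  | 0 => A
  | t + 1 => orth (iterate A p t) (p t)

/-- `d_j(A)`: the Euclidean distance of the column `a_j` to the span of the other columns. -/
noncomputable def colDist {n : ℕ} (A : Matrix (Fin n) (Fin n) ℂ) (j : Fin n) : ℝ :=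
  Metric.infDist (column A j)
    (Submodule.span ℂ (column A '' {k | k ≠ j}) : Set (EuclideanSpace ℂ (Fin n)))

/-- The potential `Φ(A) = - ∑_j log d_j(A)`. -/
noncomputable def potential {n : ℕ} (A : Matrix (Fin n) (Fin n) ℂ) : ℝ :=
  -∑ j, Real.log (colDist A j)

/-- The condition number `κ(A) = σ_1(A) / σ_n(A)`, the ratio of the largest to the smallest of the
`n` singular values (indexed from `0` in Mathlib, in decreasing order). -/
noncomputable def condNumber {n : ℕ} (A : Matrix (Fin n) (Fin n) ℂ) : ℝ :=
  (Matrix.toEuclideanLin A).singularValues 0 / (Matrix.toEuclideanLin A).singularValues (n - 1)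

end PairOrth

/-! ### Singular values, traces and the condition number. -/

namespace PairOrth

open Matrix Module

variable {n : ℕ}

/-! The proof tracks V = -log |det A| (`logVol`) in place of Φ. Gram–Schmidt gives V ≤ Φ at the
start (`neg_log_norm_det_le_potential`), and AM–GM-type bounds on the singular values give log κ ≤
log 2 + V for unit columns (`log_condNumber_le`), so it suffices to bound E V.

A step with pair (i, j) divides |det| by the residual norm, hence lowers V by at least |⟨a_i, a_j⟩|²
/ 2. Summed over ordered pairs, |⟨a_i, a_j⟩|² equals ∑ (σ_k² - 1)², which is at least 1/4 once V ≥ m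
:= (log 2 / 2) n, as then some σ_k² ≤ 1/2. So V never increases, and its expected drop at time t is
at least P(V_t ≥ m) / (8 n²).

With q = P(V_t ≥ m) this yields E V_t ≤ V_0 - q t / (8 n²) (`integral_logVol_le_sub`) and,
trivially, E V_t ≤ m + q (Φ - m) (`integral_logVol_le_convex`). The first suffices for q ≥ 1/2, the
second for q ≤ 1/2. -/

theorem toEuclideanLin_single (A : Matrix (Fin n) (Fin n) ℂ) (j : Fin n) :
    toEuclideanLin A (EuclideanSpace.single j 1) = column A j := by
  ext i
  simp [column, toLpLin_apply]

theorem linearIndependent_column_iff (A : Matrix (Fin n) (Fin n) ℂ) :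
    LinearIndependent ℂ (column A) ↔ A.det ≠ 0 := by
  have h : LinearIndependent ℂ (column A) ↔ LinearIndependent ℂ A.col :=
    (WithLp.linearEquiv 2 ℂ (Fin n → ℂ)).symm.toLinearMap.linearIndependent_iff
      (LinearEquiv.ker _)
  rw [h, linearIndependent_cols_iff_isUnit, isUnit_iff_isUnit_det, isUnit_iff_ne_zero]

/-- The squares of the singular values. -/
noncomputable def singularSq (A : Matrix (Fin n) (Fin n) ℂ) (i : Fin n) : ℝ :=
  (toEuclideanLin A).singularValues i ^ 2

theorem singularSq_nonneg (A : Matrix (Fin n) (Fin n) ℂ) (i : Fin n) : 0 ≤ singularSq A i :=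
  sq_nonneg _

theorem prod_singularSq (A : Matrix (Fin n) (Fin n) ℂ) :
    ∏ i, singularSq A i = ‖A.det‖ ^ 2 := by
  have hn : finrank ℂ (EuclideanSpace ℂ (Fin n)) = n := by simp
  set T := toEuclideanLin A with hT
  have h := T.isSymmetric_adjoint_comp_self.det_eq_prod_eigenvalues hn
  have h2 : ∏ i, singularSq A i =
      ∏ i, T.isSymmetric_adjoint_comp_self.eigenvalues hn i :=
    Finset.prod_congr rfl fun i _ => T.sq_singularValues_fin hn i
  have h3 : (LinearMap.adjoint T ∘ₗ T).det = ((‖A.det‖ ^ 2 : ℝ) : ℂ) := by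
    rw [hT, ← toEuclideanLin_conjTranspose_eq_adjoint, LinearMap.det_comp,
      LinearMap.det_toLpLin, LinearMap.det_toLpLin, det_conjTranspose]
    simp [Complex.conj_mul']
  rw [h2]
  exact Complex.ofReal_injective (by rw [← h3, h]; simp)

theorem sum_singularSq (A : Matrix (Fin n) (Fin n) ℂ) :
    ∑ i, singularSq A i = ∑ j, ‖column A j‖ ^ 2 := by
  have hn : finrank ℂ (EuclideanSpace ℂ (Fin n)) = n := by simp
  set T := toEuclideanLin A with hT
  have h2 : ∑ i, singularSq A i =
      ∑ i, T.isSymmetric_adjoint_comp_self.eigenvalues hn i :=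
    Finset.sum_congr rfl fun i _ => T.sq_singularValues_fin hn i
  have h := LinearMap.trace_eq_sum_inner (LinearMap.adjoint T ∘ₗ T)
    (T.isSymmetric_adjoint_comp_self.eigenvectorBasis hn)
  rw [LinearMap.trace_eq_sum_inner _ (EuclideanSpace.basisFun (Fin n) ℂ)] at h
  have h4 : ∀ j, inner ℂ (EuclideanSpace.basisFun (Fin n) ℂ j)
      ((LinearMap.adjoint T ∘ₗ T) (EuclideanSpace.basisFun (Fin n) ℂ j)) =
        ((‖column A j‖ ^ 2 : ℝ) : ℂ) := fun j => by
    rw [LinearMap.comp_apply, LinearMap.adjoint_inner_right, inner_self_eq_norm_sq_to_K,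
      EuclideanSpace.basisFun_apply, hT, toEuclideanLin_single]
    simp
  have h5 : ∀ i, inner ℂ (T.isSymmetric_adjoint_comp_self.eigenvectorBasis hn i)
      ((LinearMap.adjoint T ∘ₗ T) (T.isSymmetric_adjoint_comp_self.eigenvectorBasis hn i)) =
        (T.isSymmetric_adjoint_comp_self.eigenvalues hn i : ℂ) := fun i => by
    rw [LinearMap.IsSymmetric.apply_eigenvectorBasis, inner_smul_right,
      inner_self_eq_norm_sq_to_K]
    simp
  simp only [h4, h5] at h
  rw [h2]
  exact_mod_cast h.symm

/-- Both sides are the trace of (T* T)², computed in an eigenbasis and in the standard basis. -/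
theorem sum_singularSq_sq (A : Matrix (Fin n) (Fin n) ℂ) :
    ∑ i, singularSq A i ^ 2 = ∑ j, ∑ i, ‖inner ℂ (column A i) (column A j)‖ ^ 2 := by
  have hn : finrank ℂ (EuclideanSpace ℂ (Fin n)) = n := by simp
  set T := toEuclideanLin A with hT
  set S := LinearMap.adjoint T ∘ₗ T with hS
  have hsym := T.isSymmetric_adjoint_comp_self
  have h2 : ∑ i, singularSq A i ^ 2 = ∑ i, hsym.eigenvalues hn i ^ 2 :=
    Finset.sum_congr rfl fun i _ => by rw [← T.sq_singularValues_fin hn i]; rfl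
  have h := LinearMap.trace_eq_sum_inner (S ∘ₗ S) (hsym.eigenvectorBasis hn)
  rw [LinearMap.trace_eq_sum_inner _ (EuclideanSpace.basisFun (Fin n) ℂ)] at h
  have h4 : ∀ x, inner ℂ x ((S ∘ₗ S) x) = ((‖S x‖ ^ 2 : ℝ) : ℂ) := fun x => by
    rw [LinearMap.comp_apply, hS, ← hsym, inner_self_eq_norm_sq_to_K]
    push_cast
    rfl
  simp only [h4] at h
  have h5 : ∀ j, ‖S (EuclideanSpace.basisFun (Fin n) ℂ j)‖ ^ 2 =
      ∑ i, ‖inner ℂ (column A i) (column A j)‖ ^ 2 := fun j => by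
    rw [← OrthonormalBasis.sum_sq_norm_inner_right (EuclideanSpace.basisFun (Fin n) ℂ)]
    simp only [hS, EuclideanSpace.basisFun_apply, LinearMap.comp_apply,
      LinearMap.adjoint_inner_right, hT, toEuclideanLin_single]
  have h6 : ∀ i, ‖S (hsym.eigenvectorBasis hn i)‖ ^ 2 = hsym.eigenvalues hn i ^ 2 := fun i => by
    rw [hsym.apply_eigenvectorBasis, norm_smul]
    simp
  simp only [h5, h6] at h
  rw [h2]
  exact_mod_cast h.symm

theorem sum_sq_singularSq_sub_one (A : Matrix (Fin n) (Fin n) ℂ)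
    (hunit : ∀ j, ‖column A j‖ = 1) :
    ∑ i, (singularSq A i - 1) ^ 2 =
      ∑ p : IndexPair n, ‖inner ℂ (column A p.1.2) (column A p.1.1)‖ ^ 2 := by
  have h1 := sum_singularSq A
  have h2 := sum_singularSq_sq A
  simp only [hunit] at h1
  have h3 : ∑ i, (singularSq A i - 1) ^ 2 =
      ∑ i, singularSq A i ^ 2 - 2 * ∑ i, singularSq A i + n := by
    simp [sub_sq, Finset.sum_add_distrib, Finset.sum_sub_distrib, Finset.mul_sum]
  set f : Fin n × Fin n → ℝ := fun p => ‖inner ℂ (column A p.2) (column A p.1)‖ ^ 2 with hf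
  have h4 : ∑ j, ∑ i, ‖inner ℂ (column A i) (column A j)‖ ^ 2 = ∑ p, f p := by
    rw [Fintype.sum_prod_type]
  have h5 : ∑ p, f p = ∑ p : {p : Fin n × Fin n // p.1 ≠ p.2}, f p
      + ∑ p : {p : Fin n × Fin n // ¬ p.1 ≠ p.2}, f p :=
    (Fintype.sum_subtype_add_sum_subtype _ _).symm
  have h6 : ∑ p : {p : Fin n × Fin n // ¬ p.1 ≠ p.2}, f p = n := by
    have : ∀ p : {p : Fin n × Fin n // ¬ p.1 ≠ p.2}, f p = 1 := by
      rintro ⟨⟨i, j⟩, h⟩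
      obtain rfl : i = j := by simpa using h
      simp [hf, inner_self_eq_norm_sq_to_K, hunit]
    simp only [this, ne_eq]
    have hc : Fintype.card {p : Fin n × Fin n // p.1 = p.2} = n := by
      rw [Fintype.card_congr (β := Fin n) ⟨fun p => p.1.1, fun i => ⟨(i, i), rfl⟩, ?_, ?_⟩]
      · simp
      · rintro ⟨⟨i, j⟩, h⟩; simpa using h
      · intro i; rfl
    simp [hc]
  rw [h3, h2, h4, h5, h6, h1]
  simp [hf]
  ring

/-- With s_k = σ_k², the product formula turns log κ + log |det A| into log s_0 plus half the sum of
the middle log s_k. Bounding log (s_0 / 2) and each middle log s_k by log y ≤ y - 1 and using ∑ s_k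
= n leaves at most log 2. -/
theorem log_condNumber_le (hn : 2 ≤ n) (A : Matrix (Fin n) (Fin n) ℂ)
    (hunit : ∀ j, ‖column A j‖ = 1) (hdet : A.det ≠ 0) :
    Real.log (condNumber A) ≤ Real.log 2 - Real.log ‖A.det‖ := by
  have hprod := prod_singularSq A
  have hsum := sum_singularSq A
  simp only [hunit] at hsum
  have hpos : ∀ i, 0 < singularSq A i := by
    intro i
    refine (singularSq_nonneg A i).lt_of_ne' fun h0 => ?_
    rw [Finset.prod_eq_zero (Finset.mem_univ i) h0] at hprod
    exact hdet (by simpa using hprod.symm)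
  obtain ⟨m, rfl⟩ : ∃ m, n = m + 2 := ⟨n - 2, by omega⟩
  set s := singularSq A
  have hlog : ∑ i, Real.log (s i) = 2 * Real.log ‖A.det‖ := by
    rw [← Real.log_prod fun i _ => (hpos i).ne', hprod, Real.log_pow]; norm_num
  have hcond : Real.log (condNumber A) = (Real.log (s 0) - Real.log (s (Fin.last (m + 1)))) / 2 := by
    have h0 : (toEuclideanLin A).singularValues 0 ≠ 0 := fun h => by
      have := hpos 0; simp [s, singularSq, h] at this
    have h1 : (toEuclideanLin A).singularValues (m + 1) ≠ 0 := fun h => by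
      have := hpos (Fin.last (m + 1)); simp [s, singularSq, h] at this
    rw [condNumber, show m + 2 - 1 = m + 1 by omega, Real.log_div h0 h1]
    simp only [s, singularSq, Real.log_pow, Fin.val_zero, Fin.val_last]
    push_cast; ring
  have hmid : ∑ i : Fin m, Real.log (s i.succ.castSucc) ≤ ∑ i : Fin m, (s i.succ.castSucc - 1) :=
    Finset.sum_le_sum fun i _ => Real.log_le_sub_one_of_pos (hpos _)
  have htop := Real.log_le_sub_one_of_pos (half_pos (hpos 0))
  rw [Real.log_div (hpos 0).ne' two_ne_zero] at htop
  rw [Fin.sum_univ_castSucc, Fin.sum_univ_succ] at hlog hsum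
  simp only [Finset.sum_sub_distrib] at hmid
  simp at hlog hsum hmid
  have := hpos (Fin.last (m + 1))
  rw [hcond]
  linarith

end PairOrth

/-! ### Determinant against column distances, and the effect of one step. -/

namespace PairOrth

open Matrix Module

variable {n : ℕ}

/-- Gram–Schmidt: the product of the distances of the columns to the spans of the other columns
is at most the absolute value of the determinant. -/
theorem prod_colDist_le_norm_det (A : Matrix (Fin n) (Fin n) ℂ)
    (hlin : LinearIndependent ℂ (column A)) : ∏ j, colDist A j ≤ ‖A.det‖ := by
  have hn : finrank ℂ (EuclideanSpace ℂ (Fin n)) = Fintype.card (Fin n) := by simp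
  set g := InnerProductSpace.gramSchmidtOrthonormalBasis hn (column A) with hg
  set e := EuclideanSpace.basisFun (Fin n) ℂ
  have hdet : ‖A.det‖ = ∏ i, ‖inner ℂ (g i) (column A i)‖ := by
    have h1 := (toEuclideanLin A).normDet_eq_norm_det_toMatrix e e
    rw [(toEuclideanLin A).normDet_eq_norm_det_toMatrix e g] at h1
    have h2 : LinearMap.toMatrix e.toBasis e.toBasis (toEuclideanLin A) = A := by
      ext i j
      simp [e, LinearMap.toMatrix_apply, toEuclideanLin_single, column]
    have h3 : LinearMap.toMatrix e.toBasis g.toBasis (toEuclideanLin A) =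
        g.toBasis.toMatrix (column A) := by
      ext i j
      simp [e, LinearMap.toMatrix_apply, toEuclideanLin_single, Basis.toMatrix_apply]
    rw [h2, h3, ← Basis.det_apply, InnerProductSpace.gramSchmidtOrthonormalBasis_det,
      norm_prod] at h1
    exact h1.symm
  rw [hdet]
  refine Finset.prod_le_prod (fun _ _ => Metric.infDist_nonneg) fun j _ => ?_
  -- `y` is the projection of a_j onto the span of the earlier columns, so d_j ≤ ‖a_j - y‖ = |⟨g_j,
  -- a_j⟩|, a diagonal entry of the triangular factor.
  set y := column A j - inner ℂ (g j) (column A j) • g j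
  have hy : y ∈ Submodule.span ℂ (column A '' {k | k ≠ j}) := by
    have h4 : InnerProductSpace.gramSchmidt ℂ (column A) j =
        inner ℂ (g j) (column A j) • g j := by
      set v := InnerProductSpace.gramSchmidt ℂ (column A) with hv
      have hvj : v j ≠ 0 := InnerProductSpace.gramSchmidt_ne_zero j hlin
      have hvn : ((‖v j‖ : ℝ) : ℂ) ≠ 0 := by exact_mod_cast norm_ne_zero_iff.2 hvj
      have hgj : g j = ((‖v j‖ : ℝ) : ℂ)⁻¹ • v j :=
        InnerProductSpace.gramSchmidtOrthonormalBasis_apply hn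
          (smul_ne_zero (inv_ne_zero hvn) hvj)
      have hin : inner ℂ (v j) (column A j) = ((‖v j‖ : ℝ) : ℂ) ^ 2 := by
        rw [InnerProductSpace.gramSchmidt_def'' ℂ (column A) j, ← hv, inner_add_right, inner_sum,
          Finset.sum_eq_zero, add_zero, inner_self_eq_norm_sq_to_K]
        · rfl
        · intro k hk
          rw [inner_smul_right, hv,
            InnerProductSpace.gramSchmidt_orthogonal ℂ _ (Finset.mem_Iio.1 hk).ne', mul_zero]
      rw [hgj, inner_smul_left, hin, smul_smul]
      simp only [map_inv₀, Complex.conj_ofReal]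
      field_simp
      simp
    have h5 : y = column A j - InnerProductSpace.gramSchmidt ℂ (column A) j := by rw [h4]
    rw [h5, InnerProductSpace.gramSchmidt_def, sub_sub_cancel]
    refine Submodule.sum_mem _ fun k hk => ?_
    rw [Submodule.starProjection_singleton]
    refine Submodule.smul_mem _ _ ?_
    have h6 := InnerProductSpace.gramSchmidt_mem_span ℂ (column A) (le_refl k)
    refine Submodule.span_mono (Set.image_mono fun l hl => ?_) h6
    have := Finset.mem_Iio.1 hk
    exact ((Set.mem_Iic.1 hl).trans_lt this).ne
  refine (Metric.infDist_le_dist_of_mem hy).trans_eq ?_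
  rw [dist_eq_norm, sub_sub_cancel, norm_smul, g.norm_eq_one, mul_one]

theorem colDist_pos (A : Matrix (Fin n) (Fin n) ℂ)
    (hlin : LinearIndependent ℂ (column A)) (j : Fin n) : 0 < colDist A j := by
  have hclosed : IsClosed (Submodule.span ℂ (column A '' {k | k ≠ j}) :
      Set (EuclideanSpace ℂ (Fin n))) := Submodule.closed_of_finiteDimensional _
  refine (hclosed.notMem_iff_infDist_pos ⟨0, Submodule.zero_mem _⟩).1 ?_
  exact hlin.notMem_span_image (by simp)

theorem neg_log_norm_det_le_potential (A : Matrix (Fin n) (Fin n) ℂ)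
    (hlin : LinearIndependent ℂ (column A)) : -Real.log ‖A.det‖ ≤ potential A := by
  rw [potential, ← Real.log_prod fun j _ => (colDist_pos A hlin j).ne']
  exact neg_le_neg (Real.log_le_log (Finset.prod_pos fun j _ => colDist_pos A hlin j)
    (prod_colDist_le_norm_det A hlin))

theorem norm_residual_sq (A : Matrix (Fin n) (Fin n) ℂ) (hunit : ∀ j, ‖column A j‖ = 1)
    (p : IndexPair n) :
    ‖residual A p‖ ^ 2 = 1 - ‖inner ℂ (column A p.1.2) (column A p.1.1)‖ ^ 2 := by
  set x := column A p.1.1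
  set y := column A p.1.2
  have horth : inner ℂ (residual A p) (inner ℂ y x • y) = 0 := by
    simp [residual, x, y,
      inner_self_eq_norm_sq_to_K, hunit]
  have h := norm_add_sq_eq_norm_sq_add_norm_sq_of_inner_eq_zero _ _ horth
  have hx : residual A p + inner ℂ y x • y = x := by simp [residual, x, y]
  rw [hx, norm_smul, hunit p.1.1, hunit p.1.2] at h
  linarith

theorem residual_ne_zero (A : Matrix (Fin n) (Fin n) ℂ)
    (hlin : LinearIndependent ℂ (column A)) (p : IndexPair n) : residual A p ≠ 0 := by
  intro h
  rw [residual, sub_eq_zero] at h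
  refine hlin.notMem_span_image (s := {p.1.2}) (x := p.1.1) (by simpa using p.2) ?_
  rw [h]
  exact Submodule.smul_mem _ _ (Submodule.subset_span (by simp))

theorem column_orth (A : Matrix (Fin n) (Fin n) ℂ) (p : IndexPair n) (j : Fin n) :
    column (orth A p) j =
      if j = p.1.1 then ((‖residual A p‖⁻¹ : ℝ) : ℂ) • residual A p else column A j := by
  ext k
  by_cases h : j = p.1.1
  · subst h; simp [column, orth]
  · simp [column, orth, h]

theorem norm_column_orth (A : Matrix (Fin n) (Fin n) ℂ) (hunit : ∀ j, ‖column A j‖ = 1)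
    (hlin : LinearIndependent ℂ (column A)) (p : IndexPair n) (j : Fin n) :
    ‖column (orth A p) j‖ = 1 := by
  rw [column_orth]
  split_ifs
  · rw [norm_smul, Complex.norm_real, norm_inv, norm_norm,
      inv_mul_cancel₀ (norm_ne_zero_iff.2 (residual_ne_zero A hlin p))]
  · exact hunit j

theorem det_orth (A : Matrix (Fin n) (Fin n) ℂ) (p : IndexPair n) :
    (orth A p).det = ((‖residual A p‖⁻¹ : ℝ) : ℂ) * A.det := by
  have h : (fun k => ((‖residual A p‖⁻¹ : ℝ) : ℂ) * residual A p k) =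
      ((‖residual A p‖⁻¹ : ℝ) : ℂ) • fun k => A k p.1.1 +
        (-inner ℂ (column A p.1.2) (column A p.1.1)) • A k p.1.2 := by
    ext k
    simp [residual, column, sub_eq_add_neg]
  rw [orth, h, det_updateCol_smul, det_updateCol_add_smul_self _ p.2]

/-- The logarithmic volume deficit of the columns. -/
noncomputable def logVol (A : Matrix (Fin n) (Fin n) ℂ) : ℝ := -Real.log ‖A.det‖

/-- V changes by log ‖r‖ for the residual r, and 2 log ‖r‖ ≤ ‖r‖² - 1 = -|⟨a_i, a_j⟩|² by
Pythagoras. -/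
theorem logVol_orth_le (A : Matrix (Fin n) (Fin n) ℂ) (hunit : ∀ j, ‖column A j‖ = 1)
    (hlin : LinearIndependent ℂ (column A)) (p : IndexPair n) :
    logVol (orth A p) ≤
      logVol A - ‖inner ℂ (column A p.1.2) (column A p.1.1)‖ ^ 2 / 2 := by
  have hr := norm_pos_iff.2 (residual_ne_zero A hlin p)
  have hd := (linearIndependent_column_iff A).1 hlin
  have h1 := norm_residual_sq A hunit p
  have h2 := Real.log_le_sub_one_of_pos (pow_pos hr 2)
  rw [Real.log_pow] at h2
  rw [logVol, logVol, det_orth, norm_mul, Complex.norm_real, norm_inv, norm_norm,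
    Real.log_mul (inv_ne_zero hr.ne') (norm_ne_zero_iff.2 hd), Real.log_inv]
  push_cast at h2
  linarith

theorem linearIndependent_orth (A : Matrix (Fin n) (Fin n) ℂ)
    (hlin : LinearIndependent ℂ (column A)) (p : IndexPair n) :
    LinearIndependent ℂ (column (orth A p)) := by
  rw [linearIndependent_column_iff] at hlin ⊢
  rw [det_orth]
  exact mul_ne_zero (by simpa using residual_ne_zero A ((linearIndependent_column_iff A).2 hlin) p)
    hlin

theorem sum_inner_sq_ge (A : Matrix (Fin n) (Fin n) ℂ) (hunit : ∀ j, ‖column A j‖ = 1)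
    (hn : 0 < n)
    (hvol : Real.log 2 / 2 * n ≤ logVol A) :
    1 / 4 ≤ ∑ p : IndexPair n, ‖inner ℂ (column A p.1.2) (column A p.1.1)‖ ^ 2 := by
  rw [← sum_sq_singularSq_sub_one A hunit]
  obtain ⟨i, hi⟩ : ∃ i, singularSq A i ≤ 1 / 2 := by
    by_contra! h
    -- If all σ_i² exceeded 1/2, then |det A|² > 2⁻ⁿ, contradicting `hvol`.
    have h1 : ∑ _i : Fin n, Real.log (1 / 2) < ∑ i, Real.log (singularSq A i) :=
      Finset.sum_lt_sum_of_nonempty ⟨⟨0, hn⟩, Finset.mem_univ _⟩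
        fun i _ => Real.log_lt_log (by norm_num) (h i)
    rw [← Real.log_prod fun i _ => ((by norm_num : (0 : ℝ) < 1 / 2).trans (h i)).ne',
      prod_singularSq, Real.log_pow] at h1
    simp [logVol] at h1 hvol
    linarith
  have h2 : (singularSq A i - 1) ^ 2 ≤ ∑ i, (singularSq A i - 1) ^ 2 :=
    Finset.single_le_sum (f := fun i => (singularSq A i - 1) ^ 2)
      (fun _ _ => sq_nonneg _) (Finset.mem_univ i)
  nlinarith

theorem iterate_invariant (A : Matrix (Fin n) (Fin n) ℂ) (hunit : ∀ j, ‖column A j‖ = 1)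
    (hlin : LinearIndependent ℂ (column A)) (p : ℕ → IndexPair n) (t : ℕ) :
    (∀ j, ‖column (iterate A p t) j‖ = 1) ∧ LinearIndependent ℂ (column (iterate A p t)) := by
  induction t with
  | zero => exact ⟨hunit, hlin⟩
  | succ t ih => exact ⟨norm_column_orth _ ih.1 ih.2 _, linearIndependent_orth _ ih.2 _⟩

theorem iterate_congr (A : Matrix (Fin n) (Fin n) ℂ) {p q : ℕ → IndexPair n} {t : ℕ}
    (h : ∀ s < t, p s = q s) : iterate A p t = iterate A q t := by
  induction t with
  | zero => rfl
  | succ t ih => rw [iterate, iterate, ih fun s hs => h s (hs.trans t.lt_succ_self),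
      h t t.lt_succ_self]

end PairOrth

/-! ### Averaging over the random pairs. -/

namespace PairOrth

open MeasureTheory ProbabilityTheory

variable {n : ℕ}

theorem integral_uniformOn_univ {β : Type*} [Fintype β] [Nonempty β] [MeasurableSpace β]
    [MeasurableSingletonClass β] (f : β → ℝ) :
    ∫ y, f y ∂(uniformOn Set.univ) = (Fintype.card β : ℝ)⁻¹ * ∑ y, f y := by
  have := isProbabilityMeasure_uniformOn (Set.finite_univ (α := β)) Set.univ_nonempty
  rw [integral_fintype .of_finite, Finset.mul_sum]
  refine Finset.sum_congr rfl fun y _ => ?_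
  simp [Measure.real, uniformOn_univ]

/-- Averaging out an independent uniform variable. -/
theorem integral_comp_indep_uniform {Ω α β : Type*} [MeasurableSpace Ω] {P : Measure Ω}
    [IsProbabilityMeasure P] [Finite α] [MeasurableSpace α] [MeasurableSingletonClass α]
    [Fintype β] [Nonempty β] [MeasurableSpace β] [MeasurableSingletonClass β]
    {X : Ω → α} {Y : Ω → β} (hX : Measurable X) (hY : Measurable Y) (hXY : IndepFun X Y P)
    (hunif : P.map Y = uniformOn Set.univ) (g : α → β → ℝ) :
    ∫ ω, g (X ω) (Y ω) ∂P = ∫ ω, (Fintype.card β : ℝ)⁻¹ * ∑ y, g (X ω) y ∂P := by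
  have hPX := Measure.isProbabilityMeasure_map (μ := P) hX.aemeasurable
  have hPY := Measure.isProbabilityMeasure_map (μ := P) hY.aemeasurable
  have h1 : ∫ ω, g (X ω) (Y ω) ∂P =
      ∫ z, g z.1 z.2 ∂(P.map fun ω => (X ω, Y ω)) := by
    rw [integral_map (hX.prodMk hY).aemeasurable
      (measurable_of_finite fun z : α × β => g z.1 z.2).aestronglyMeasurable]
  rw [h1, (indepFun_iff_map_prod_eq_prod_map_map hX.aemeasurable hY.aemeasurable).1 hXY,
    integral_prod _ .of_finite]
  simp only [hunif, integral_uniformOn_univ]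
  rw [integral_map hX.aemeasurable (measurable_of_finite _).aestronglyMeasurable]

section RandomWalk

variable (A : Matrix (Fin n) (Fin n) ℂ) {Ω : Type*} [MeasurableSpace Ω] {P : Measure Ω}
  [IsProbabilityMeasure P] {p : ℕ → Ω → IndexPair n}

/-- The history of the process up to time `t`. -/
def history (p : ℕ → Ω → IndexPair n) (t : ℕ) (ω : Ω) : Finset.range t → IndexPair n :=
  fun s => p s ω

theorem measurable_history (hmeas : ∀ t, Measurable (p t)) (t : ℕ) : Measurable (history p t) :=
  measurable_pi_lambda _ fun s => hmeas s

/-- A_t depends only on the finitely many possible histories, so every real function of A_t is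
measurable and integrable, and A_t is independent of the pair drawn at time t. -/
theorem exists_iterate_eq [Nonempty (IndexPair n)] (t : ℕ) :
    ∃ B : (Finset.range t → IndexPair n) → Matrix (Fin n) (Fin n) ℂ,
      ∀ q : ℕ → IndexPair n, iterate A q t = B fun s => q s := by
  classical
  refine ⟨fun x => iterate A (fun s => if h : s ∈ Finset.range t then x ⟨s, h⟩ else
    Classical.arbitrary _) t, fun q => iterate_congr A fun s hs => ?_⟩
  simp [hs]

theorem integrable_comp_iterate [Nonempty (IndexPair n)] (hmeas : ∀ t, Measurable (p t)) (t : ℕ)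
    (f : Matrix (Fin n) (Fin n) ℂ → ℝ) :
    Integrable (fun ω => f (iterate A (fun s => p s ω) t)) P := by
  obtain ⟨B, hB⟩ := exists_iterate_eq A t
  have hH := measurable_history hmeas t
  have := Measure.isProbabilityMeasure_map (μ := P) hH.aemeasurable
  have h : Integrable (fun x => f (B x)) (P.map (history p t)) := .of_finite
  simp only [hB]
  exact h.comp_measurable hH

theorem integral_iterate_step [Nonempty (IndexPair n)] (hmeas : ∀ t, Measurable (p t))
    (hindep : iIndepFun p P) (hunif : ∀ t, P.map (p t) = uniformOn Set.univ) (t : ℕ)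
    (g : Matrix (Fin n) (Fin n) ℂ → IndexPair n → ℝ) :
    ∫ ω, g (iterate A (fun s => p s ω) t) (p t ω) ∂P =
      ∫ ω, (Fintype.card (IndexPair n) : ℝ)⁻¹ *
        ∑ y, g (iterate A (fun s => p s ω) t) y ∂P := by
  obtain ⟨B, hB⟩ := exists_iterate_eq A t
  have hind : IndepFun (history p t) (p t) P :=
    (hindep.indepFun_finset (Finset.range t) {t} (by simp) hmeas).comp measurable_id
      (measurable_pi_apply (⟨t, by simp⟩ : ({t} : Finset ℕ)))
  simp only [hB]
  exact integral_comp_indep_uniform (measurable_history hmeas t) (hmeas t) hind (hunif t)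
    fun x y => g (B x) y

theorem logVol_iterate_succ_le (hunit : ∀ j, ‖column A j‖ = 1)
    (hlin : LinearIndependent ℂ (column A)) (q : ℕ → IndexPair n) (t : ℕ) :
    logVol (iterate A q (t + 1)) ≤ logVol (iterate A q t) -
      ‖inner ℂ (column (iterate A q t) (q t).1.2) (column (iterate A q t) (q t).1.1)‖ ^ 2 / 2 :=
  have h := iterate_invariant A hunit hlin q t
  logVol_orth_le _ h.1 h.2 _

theorem antitone_logVol_iterate (hunit : ∀ j, ‖column A j‖ = 1)
    (hlin : LinearIndependent ℂ (column A)) (q : ℕ → IndexPair n) :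
    Antitone fun t => logVol (iterate A q t) :=
  antitone_nat_of_succ_le fun t => (logVol_iterate_succ_le A hunit hlin q t).trans
    (sub_le_self _ (by positivity))

/-- The indicator that the logarithmic volume is at least `(log 2 / 2) n`. -/
noncomputable def isLarge (A : Matrix (Fin n) (Fin n) ℂ) : ℝ :=
  if Real.log 2 / 2 * n ≤ logVol A then 1 else 0

theorem isLarge_nonneg : 0 ≤ isLarge A := by
  rw [isLarge]; split_ifs <;> norm_num

theorem card_indexPair_le : (Fintype.card (IndexPair n) : ℝ) ≤ (n : ℝ) ^ 2 := by
  have h := Fintype.card_subtype_le fun p : Fin n × Fin n => p.1 ≠ p.2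
  rw [Fintype.card_prod, Fintype.card_fin, ← sq] at h
  exact_mod_cast h

theorem integral_logVol_succ_le [Nonempty (IndexPair n)] (hn : 0 < n)
    (hunit : ∀ j, ‖column A j‖ = 1) (hlin : LinearIndependent ℂ (column A))
    (hmeas : ∀ t, Measurable (p t)) (hindep : iIndepFun p P)
    (hunif : ∀ t, P.map (p t) = uniformOn Set.univ) (t : ℕ) :
    ∫ ω, logVol (iterate A (fun s => p s ω) (t + 1)) ∂P ≤
      ∫ ω, logVol (iterate A (fun s => p s ω) t) ∂P -
        (∫ ω, isLarge (iterate A (fun s => p s ω) t) ∂P) / (8 * (n : ℝ) ^ 2) := by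
  set g : Matrix (Fin n) (Fin n) ℂ → IndexPair n → ℝ :=
    fun B y => ‖inner ℂ (column B y.1.2) (column B y.1.1)‖ ^ 2 with hg
  set N : ℝ := (Fintype.card (IndexPair n) : ℝ)
  have hN : 0 < N := Nat.cast_pos.2 Fintype.card_pos
  have hNn : N ≤ (n : ℝ) ^ 2 := card_indexPair_le
  have hn' : (0 : ℝ) < n := by exact_mod_cast hn
  have hint := fun f => integrable_comp_iterate (P := P) A hmeas t f
  have hdrop : (∫ ω, isLarge (iterate A (fun s => p s ω) t) ∂P) / (8 * (n : ℝ) ^ 2) ≤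
      ∫ ω, logVol (iterate A (fun s => p s ω) t) - logVol (iterate A (fun s => p s ω) (t + 1)) ∂P
      := by
    have hs := integral_iterate_step (P := P) A hmeas hindep hunif t
      fun B y => logVol B - logVol (orth B y)
    refine le_of_le_of_eq ?_ hs.symm
    rw [← integral_div]
    refine integral_mono (hint fun B => isLarge B / (8 * (n : ℝ) ^ 2))
      (hint fun B => N⁻¹ * ∑ y, (logVol B - logVol (orth B y))) fun ω => ?_
    obtain ⟨hu, hl⟩ := iterate_invariant A hunit hlin (fun s => p s ω) t
    set B := iterate A (fun s => p s ω) t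
    have h1 : ∑ y, g B y / 2 ≤ ∑ y, (logVol B - logVol (orth B y)) :=
      Finset.sum_le_sum fun y _ => by have := logVol_orth_le B hu hl y; linarith
    have h2 : isLarge B / 8 ≤ ∑ y, g B y / 2 := by
      rw [← Finset.sum_div]
      by_cases h : Real.log 2 / 2 * n ≤ logVol B
      · have := sum_inner_sq_ge B hu hn h
        simp only [isLarge, if_pos h]
        linarith
      · simp only [isLarge, if_neg h, zero_div]
        exact div_nonneg (Finset.sum_nonneg fun _ _ => sq_nonneg _) zero_le_two
    -- The average is over N ≤ n² pairs.
    calc isLarge B / (8 * (n : ℝ) ^ 2) ≤ isLarge B / (8 * N) := by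
          have := isLarge_nonneg B
          gcongr
      _ = N⁻¹ * (isLarge B / 8) := by field_simp
      _ ≤ _ := by gcongr; exact h2.trans h1
  rw [integral_sub (hint logVol) (integrable_comp_iterate A hmeas (t + 1) logVol)] at hdrop
  linarith

theorem isLarge_iterate_antitone (hunit : ∀ j, ‖column A j‖ = 1)
    (hlin : LinearIndependent ℂ (column A)) (q : ℕ → IndexPair n) :
    Antitone fun t => isLarge (iterate A q t) := by
  intro s t hst
  have h := antitone_logVol_iterate A hunit hlin q hst
  simp only [isLarge]
  split_ifs with h1 h2
  · exact le_rfl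
  · exact absurd (h1.trans h) h2
  · exact zero_le_one
  · exact le_rfl

theorem integral_logVol_le_sub [Nonempty (IndexPair n)] (hn : 0 < n)
    (hunit : ∀ j, ‖column A j‖ = 1) (hlin : LinearIndependent ℂ (column A))
    (hmeas : ∀ t, Measurable (p t)) (hindep : iIndepFun p P)
    (hunif : ∀ t, P.map (p t) = uniformOn Set.univ) (t : ℕ) :
    ∫ ω, logVol (iterate A (fun s => p s ω) t) ∂P ≤ logVol A -
      (∫ ω, isLarge (iterate A (fun s => p s ω) t) ∂P) * (t / (n : ℝ) ^ 2) / 8 := by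
  -- The final time T stays fixed in the induction: V is nonincreasing, so P(V_s ≥ m) ≥ P(V_T ≥ m)
  -- and every earlier step gains at least the drop computed at T.
  have key : ∀ T, ∀ s ≤ T, ∫ ω, logVol (iterate A (fun s => p s ω) s) ∂P ≤ logVol A -
      (∫ ω, isLarge (iterate A (fun s => p s ω) T) ∂P) * (s / (n : ℝ) ^ 2) / 8 := by
    intro T s hs
    induction s with
    | zero => simp [iterate]
    | succ s ih =>
      have h1 := integral_logVol_succ_le (P := P) A hn hunit hlin hmeas hindep hunif s
      have h2 := ih (by omega)
      have h3 : ∫ ω, isLarge (iterate A (fun s => p s ω) T) ∂P ≤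
          ∫ ω, isLarge (iterate A (fun r => p r ω) s) ∂P :=
        integral_mono (integrable_comp_iterate A hmeas T isLarge)
          (integrable_comp_iterate A hmeas s isLarge)
          fun ω => isLarge_iterate_antitone A hunit hlin _ (by omega)
      have h4 := div_le_div_of_nonneg_right h3 (by positivity : 0 ≤ 8 * (n : ℝ) ^ 2)
      have h5 : ∀ q : ℝ, q * (((s + 1 : ℕ) : ℝ) / (n : ℝ) ^ 2) / 8 =
          q * (s / (n : ℝ) ^ 2) / 8 + q / (8 * (n : ℝ) ^ 2) := by
        intro q
        have : (n : ℝ) ≠ 0 := by exact_mod_cast hn.ne'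
        push_cast
        field_simp
      rw [h5]
      linarith
  exact key t t le_rfl

/-- Pointwise, V_t ≤ m off the event V_t ≥ m, and V_t ≤ V_0 ≤ C on it. -/
theorem integral_logVol_le_convex [Nonempty (IndexPair n)]
    (hunit : ∀ j, ‖column A j‖ = 1) (hlin : LinearIndependent ℂ (column A))
    (hmeas : ∀ t, Measurable (p t)) {C : ℝ} (hC : logVol A ≤ C) (t : ℕ) :
    ∫ ω, logVol (iterate A (fun s => p s ω) t) ∂P ≤
      Real.log 2 / 2 * n + (∫ ω, isLarge (iterate A (fun s => p s ω) t) ∂P) *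
        (C - Real.log 2 / 2 * n) := by
  have h : ∫ ω, logVol (iterate A (fun s => p s ω) t) ∂P ≤
      ∫ ω, (Real.log 2 / 2 * n + isLarge (iterate A (fun s => p s ω) t) *
        (C - Real.log 2 / 2 * n)) ∂P := by
    refine integral_mono (integrable_comp_iterate A hmeas t logVol)
      (integrable_comp_iterate A hmeas t fun B => Real.log 2 / 2 * n + isLarge B *
        (C - Real.log 2 / 2 * n)) fun ω => ?_
    have h1 : logVol (iterate A (fun s => p s ω) t) ≤ logVol A :=
      antitone_logVol_iterate A hunit hlin (fun s => p s ω) t.zero_le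
    simp only [isLarge]
    split_ifs with h2 <;> linarith
  rwa [integral_add (integrable_const _) (integrable_comp_iterate A hmeas t fun B => isLarge B *
        (C - Real.log 2 / 2 * n)), integral_const, probReal_univ, one_smul, integral_mul_const] at h

end RandomWalk

end PairOrth

/-! ### Conclusion: combining the two bounds on E V_t. -/

theorem proposition2p8 {n : ℕ} (hn : 2 ≤ n)
    (A : Matrix (Fin n) (Fin n) ℂ)
    (hunit : ∀ j, ‖PairOrth.column A j‖ = 1)
    (hlin : LinearIndependent ℂ (PairOrth.column A))
    {Ω : Type*} [MeasurableSpace Ω] (P : MeasureTheory.Measure Ω)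
    [MeasureTheory.IsProbabilityMeasure P]
    (p : ℕ → Ω → PairOrth.IndexPair n)
    (hmeas : ∀ t, Measurable (p t))
    (hindep : ProbabilityTheory.iIndepFun p P)
    (hunif : ∀ t, P.map (p t) = ProbabilityTheory.uniformOn Set.univ)
    (hΦ : Real.log 2 / 2 * n ≤ PairOrth.potential A)
    (t : ℕ) (ht : (t : ℝ) ≤ (n : ℝ) ^ 2 * PairOrth.potential A) :
    (∀ ω, LinearIndependent ℂ
      (PairOrth.column (PairOrth.iterate A (fun s => p s ω) t))) ∧
    MeasureTheory.Integrable
      (fun ω => Real.log (PairOrth.condNumber (PairOrth.iterate A (fun s => p s ω) t))) P ∧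
    ∫ ω, Real.log (PairOrth.condNumber (PairOrth.iterate A (fun s => p s ω) t)) ∂P ≤
      Real.log n + PairOrth.potential A
        - 1 / 96 * (1 - Real.log 2 / 2 * n / PairOrth.potential A) * ((t : ℝ) / (n : ℝ) ^ 2) := by
  have : Nonempty (PairOrth.IndexPair n) :=
    ⟨⟨(⟨0, by omega⟩, ⟨1, by omega⟩), by simp⟩⟩
  have hn0 : (0 : ℝ) < n := by exact_mod_cast (by omega : 0 < n)
  have hint := PairOrth.integrable_comp_iterate (P := P) A hmeas t
    fun B => Real.log (PairOrth.condNumber B)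
  refine ⟨fun ω => (PairOrth.iterate_invariant A hunit hlin _ t).2, hint, ?_⟩
  have hintV := PairOrth.integrable_comp_iterate (P := P) A hmeas t PairOrth.logVol
  have hcond : ∫ ω, Real.log (PairOrth.condNumber (PairOrth.iterate A (fun s => p s ω) t)) ∂P ≤
      Real.log 2 + ∫ ω, PairOrth.logVol (PairOrth.iterate A (fun s => p s ω) t) ∂P := by
    have h : ∫ ω, Real.log (PairOrth.condNumber (PairOrth.iterate A (fun s => p s ω) t)) ∂P ≤
        ∫ ω, (Real.log 2 + PairOrth.logVol (PairOrth.iterate A (fun s => p s ω) t)) ∂P := by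
      refine MeasureTheory.integral_mono hint
        ((MeasureTheory.integrable_const _).add hintV) fun ω => ?_
      obtain ⟨hu, hl⟩ := PairOrth.iterate_invariant A hunit hlin (fun s => p s ω) t
      exact PairOrth.log_condNumber_le hn _ hu ((PairOrth.linearIndependent_column_iff _).1 hl)
    rwa [MeasureTheory.integral_add (MeasureTheory.integrable_const _) hintV,
      MeasureTheory.integral_const, MeasureTheory.probReal_univ, one_smul] at h
  have hlogn : Real.log 2 ≤ Real.log n := Real.log_le_log two_pos (by exact_mod_cast hn)
  have hV : PairOrth.logVol A ≤ PairOrth.potential A :=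
    PairOrth.neg_log_norm_det_le_potential A hlin
  have h1 := PairOrth.integral_logVol_le_sub (P := P) A (by omega) hunit hlin hmeas hindep hunif t
  have h2 := PairOrth.integral_logVol_le_convex (P := P) A hunit hlin hmeas hV t
  set q := ∫ ω, PairOrth.isLarge (PairOrth.iterate A (fun s => p s ω) t) ∂P
  set F := PairOrth.potential A
  set m := Real.log 2 / 2 * n with hm
  set x : ℝ := t / (n : ℝ) ^ 2
  have hm0 : 0 < m := by have := Real.log_pos one_lt_two; positivity
  have hF : 0 < F := hm0.trans_le hΦ
  have hx0 : 0 ≤ x := by positivity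
  have hxF : x ≤ F := (div_le_iff₀ (by positivity)).2 (by linarith)
  have hr0 : 0 ≤ 1 - m / F := sub_nonneg.2 ((div_le_one hF).2 hΦ)
  have hr1 : 1 - m / F ≤ 1 := sub_le_self _ (div_nonneg hm0.le hF.le)
  have hrF : (1 - m / F) * F = F - m := by field_simp
  have hrx : (1 - m / F) * x ≤ F - m := hrF ▸ mul_le_mul_of_nonneg_left hxF hr0
  have hrx' : (1 - m / F) * x ≤ x := mul_le_of_le_one_left hx0 hr1
  -- For q ≥ 1/2 the drop is at least x/16. For q ≤ 1/2 it is at least (F - m)/2, where F - m ≥ (1 -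
  -- m/F) x because x ≤ F; this is where the bound on t enters. Both exceed what the constant 1/96
  -- requires.
  rcases le_total (1 / 2) q with hq | hq
  · have := mul_le_mul_of_nonneg_right hq hx0
    linarith
  · have := mul_le_mul_of_nonneg_right hq (sub_nonneg.2 hΦ)
    linarith
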